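/- Let $A\in\{0,1\}^{m\times d}$ be a dictionary with rows $a_1,\dots,a_m$, let $h$ denote the Hamming distance, let $\phi_A(z)=(h(a_1,z),\dots,h(a_m,z))\in\mathbb R^m$ for $z\in\{0,1\}^d$, and let $\mathcal S_A=\{\phi_A(z): z\in\{0,1\}^d\}$. Let $k_{\rm base}$ be a kernel on $\mathbb R^m$ with $k_{\rm base}(s,s)\le B$ for $s\in\mathcal S_A$, and let $f$ be a sample of a zero-mean Gaussian process on $\{0,1\}^d$ with kernel $k(z,z')=k_{\rm base}(\phi_A(z),\phi_A(z'))$. Let $\delta\in(0,1)$ and $\beta_t=2\log\bigl(|\mathcal S_A|\,t^2\pi^2/(6\delta)\bigr)$. Run GP-UCB: in round $t=1,2,\dots$ query a maximizer $z_t\in\{0,1\}^d$ of $\mu_{t-1}(z)+\sqrt{\beta_t}\,\sigma_{t-1}(z)$ (ties being broken by a measurable function of the past data) and observe $y_t=f(z_t)+\varepsilon_t$, where the $\varepsilon_t\sim\mathcal N(0,\sigma^2)$, $\sigma>0$, are independent of each other and of $f$, and $\mu_{t-1},\sigma_{t-1}^2$ are the Gaussian process predictive mean and variance (prior kernel $k$,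 noise variance $\sigma^2$) given the first $t-1$ queries and observations. Let $R_T=\sum_{t=1}^T\bigl(\max_z f(z)-f(z_t)\bigr)$ be the cumulative regret and let $$\gamma_T=\max_{s_1,\dots,s_T\in\mathcal S_A}\tfrac12\log\det\bigl(I+\sigma^{-2}(k_{\rm base}(s_i,s_j))_{i,j\le T}\bigr)$$ be the maximum information gain of $k_{\rm base}$. Then with probability at least $1-\delta$ the cumulative regret is $O^*(\sqrt{T\gamma_T m})$, where $O^*$ suppresses logarithmic factors in $T$, $d$ and $1/\delta$. Precisely: there is a constant $C>0$ depending only on $\sigma$ and $B$ such that, with probability at least $1-\delta$, for all $T\ge1$ simultaneously, $$R_T\le C\,\sqrt{T\,\gamma_T\,m}\,\sqrt{1+\log T+\log(d+1)+\log(1/\delta)}.$$ -/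

import Mathlib

open MeasureTheory ProbabilityTheory
open scoped Matrix

noncomputable section

namespace DictBO

/-! ### The dictionary embedding -/

/-- The Hamming embedding `φ_A(z) = (h(a_1, z), …, h(a_m, z))` of a binary vector `z ∈ {0,1}^d`,
where `a_1, …, a_m ∈ {0,1}^d` are the rows of the dictionary `A` and `h` is the Hamming distance. -/
def embed {m d : ℕ} (A : Fin m → Fin d → Bool) (z : Fin d → Bool) : Fin m → ℝ :=
  fun i => (hammingDist (A i) z : ℝ)

/-- The embedded search space `S_A = {φ_A(z) | z ∈ {0,1}^d}`. -/
def embeddedSpace {m d : ℕ} (A : Fin m → Fin d → Bool) : Set (Fin m → ℝ) :=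
  Set.range (embed A)

/-- The dictionary kernel `k(z, z') = k_base(φ_A(z), φ_A(z'))`. -/
def dictKernel {m d : ℕ} (A : Fin m → Fin d → Bool)
    (kbase : (Fin m → ℝ) → (Fin m → ℝ) → ℝ) (z z' : Fin d → Bool) : ℝ :=
  kbase (embed A z) (embed A z')

/-! ### Gaussian process regression with observation noise of variance `σ ^ 2` -/

section GP

variable {X : Type*}

/-- The kernel matrix `(k(x_i, x_j))_{i,j}`. -/
def gram (k : X → X → ℝ) {t : ℕ} (x : Fin t → X) : Matrix (Fin t) (Fin t) ℝ :=
  Matrix.of fun i j => k (x i) (x j)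

/-- The vector `(k(x_i, p))_i`. -/
def crossCov (k : X → X → ℝ) {t : ℕ} (x : Fin t → X) (p : X) : Fin t → ℝ :=
  fun i => k (x i) p

/-- Predictive mean at `p` given the observations `y` at the points `x`. -/
def postMean (k : X → X → ℝ) (σ : ℝ) {t : ℕ} (x : Fin t → X) (y : Fin t → ℝ) (p : X) : ℝ :=
  crossCov k x p ⬝ᵥ ((gram k x + σ ^ 2 • (1 : Matrix (Fin t) (Fin t) ℝ))⁻¹ *ᵥ y)

/-- Predictive variance at `p` given observations at the points `x`. -/
def postVar (k : X → X → ℝ) (σ : ℝ) {t : ℕ} (x : Fin t → X) (p : X) : ℝ :=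
  k p p - crossCov k x p ⬝ᵥ
    ((gram k x + σ ^ 2 • (1 : Matrix (Fin t) (Fin t) ℝ))⁻¹ *ᵥ crossCov k x p)

/-- The upper confidence bound acquisition function: predictive mean plus `√b` times the
predictive standard deviation. -/
def ucb (k : X → X → ℝ) (σ b : ℝ) {t : ℕ} (x : Fin t → X) (y : Fin t → ℝ) (p : X) : ℝ :=
  postMean k σ x y p + √b * √(postVar k σ x p)

/-- The information gain `1/2 * log det (I + σ⁻² K)` of noisy observations at the points `x`. -/
def infoGain (k : X → X → ℝ) (σ : ℝ) {t : ℕ} (x : Fin t → X) : ℝ :=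
  1 / 2 * Real.log (1 + (σ ^ 2)⁻¹ • gram k x).det

/-- The maximum information gain `γ_T` over all choices (repetitions allowed) of `T` points
of the search space `S`. -/
def maxInfoGain (k : X → X → ℝ) (σ : ℝ) (S : Set X) (T : ℕ) : ℝ :=
  ⨆ x : Fin T → S, infoGain k σ (fun i => (x i : X))

end GP

/-! ### GP-UCB and its regret -/

/-- The confidence parameter `β_t = 2 log(|S_A| t² π² / (6δ))`, for `t = 1, 2, …`. -/
def beta {m d : ℕ} (A : Fin m → Fin d → Bool) (δ : ℝ) (t : ℕ) : ℝ :=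
  2 * Real.log ((embeddedSpace A).ncard * (t : ℝ) ^ 2 * Real.pi ^ 2 / (6 * δ))

/-- The noisy observation in round `t`: the value of `f` at the queried point plus noise. -/
def obs {X Ω : Type*} (f : X → Ω → ℝ) (ε : ℕ → Ω → ℝ) (z : ℕ → Ω → X) (t : ℕ) (ω : Ω) : ℝ :=
  f (z t ω) ω + ε t ω

/-- `z 0, z 1, …` are the points queried by GP-UCB (`z t` is the query of round `t + 1`, with
parameter `b (t + 1)`): each query maximizes the acquisition function computed from the past
queries and observations, and is selected (this concerns how ties are broken) by a measurable
function of these data. -/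
structure IsGPUCBRun {X Ω : Type*} [MeasurableSpace X] (k : X → X → ℝ) (σ : ℝ) (b : ℕ → ℝ)
    (f : X → Ω → ℝ) (ε : ℕ → Ω → ℝ) (z : ℕ → Ω → X) : Prop where
  history_dependent : ∀ t : ℕ, ∃ rule : (Fin t → X × ℝ) → X, Measurable rule ∧
    ∀ ω, z t ω = rule fun i => (z i ω, obs f ε z i ω)
  maximizes : ∀ (t : ℕ) (ω : Ω) (p : X),
    ucb k σ (b (t + 1)) (fun i : Fin t => z i ω) (fun i : Fin t => obs f ε z i ω) p ≤
      ucb k σ (b (t + 1)) (fun i : Fin t => z i ω) (fun i : Fin t => obs f ε z i ω) (z t ω)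

/-- The cumulative regret `R_T = ∑_{t=1}^T (max f - f(z_t))`. -/
def cumRegret {X Ω : Type*} (f : X → Ω → ℝ) (z : ℕ → Ω → X) (T : ℕ) (ω : Ω) : ℝ :=
  ∑ t ∈ Finset.range T, ((⨆ p, f p ω) - f (z t ω) ω)

end DictBO

end

/-!
The proof is the Gaussian process bandit argument of Srinivas, Krause, Kakade and Seeger, with the
union bound taken over the embedded space, whose size is at most `(d + 1) ^ m`.

The probabilistic core is that the confidence bounds remain valid although the queries depend on
the noise. At fixed points, the error of the predictive mean is Gaussian with the predictive
variance and, by the normal equations, uncorrelated with the data; joint Gaussianity makes it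
independent of the data (`NoisyGP.indepFun_obs_residual`). There are only finitely many possible
query histories, and the event that a given one occurs depends on the data at its own points only,
so summing over histories replaces conditioning (`NoisyGP.measure_adaptive_le`). With the Gaussian
tail bound `exp (-b / 2)`, the choice of `β_t` makes the total failure probability at most `δ`
(`measure_confidence_ge`).

When all bounds hold, the regret of a round is at most `2 √β_t` times the predictive standard
deviation at the query (`sum_regret_le`). By a Schur complement, the information gain is half the
sum of `log (1 + s_t / σ ^ 2)` over the predictive variances `s_t` at the queries
(`infoGain_eq_sum`), so the sum of the `s_t` is at most `2 (σ ^ 2 + B)` times the information gain.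
Cauchy–Schwarz and `β_T = O(m (1 + log T + log (d + 1) + log (1 / δ)))` (`beta_le`) conclude.
-/

namespace DictBO

/-! ### The Gaussian tail -/

theorem gaussianReal_Ioi_le (v : NNReal) (hv : v ≠ 0) {c : ℝ} (hc : 0 ≤ c) :
    gaussianReal 0 v (Set.Ioi c) ≤
      ENNReal.ofReal (Real.exp (-c ^ 2 / (2 * v))) * gaussianReal 0 v (Set.Ioi 0) := by
  have hv' : (0 : ℝ) < v := by positivity
  rw [gaussianReal_apply _ hv, gaussianReal_apply _ hv,
    ← lintegral_const_mul _ (measurable_gaussianPDF 0 v),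
    ← lintegral_indicator measurableSet_Ioi, ← lintegral_indicator measurableSet_Ioi,
    ← lintegral_add_right_eq_self _ c]
  refine lintegral_mono fun x => ?_
  by_cases hx : 0 < x
  · rw [Set.indicator_of_mem (by simpa using hx), Set.indicator_of_mem (by simpa using hx),
      gaussianPDF, gaussianPDF, ← ENNReal.ofReal_mul (by positivity)]
    refine ENNReal.ofReal_le_ofReal ?_
    rw [gaussianPDFReal, gaussianPDFReal, mul_left_comm, ← Real.exp_add]
    gcongr
    rw [← add_div]
    gcongr
    nlinarith [mul_nonneg hx.le hc]
  · rw [Set.indicator_of_notMem (by simpa using hx)]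
    exact zero_le

/-- The two-sided Gaussian tail bound with constant `1`: the mass beyond `√b` standard deviations
is at most `exp (-b / 2)`. The usual Chernoff bound would lose a factor `2`, which the choice of
the confidence parameter does not leave room for. -/
theorem gaussianReal_abs_gt_le (v : NNReal) {b : ℝ} (hb : 0 ≤ b) :
    gaussianReal 0 v {x | √b * √v < |x|} ≤ ENNReal.ofReal (Real.exp (-b / 2)) := by
  rcases eq_or_ne v 0 with rfl | hv
  · have hm : MeasurableSet {x : ℝ | √b * √((0 : NNReal) : ℝ) < |x|} :=
      measurableSet_lt measurable_const continuous_abs.measurable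
    rw [gaussianReal_zero_var, Measure.dirac_apply' _ hm]
    simp
  have hv' : (0 : ℝ) < v := by positivity
  set c := √b * √(v : ℝ) with hc
  have hc0 : 0 ≤ c := by positivity
  have hexp : -c ^ 2 / (2 * v) = -b / 2 := by
    rw [hc, mul_pow, Real.sq_sqrt hb, Real.sq_sqrt hv'.le]
    field_simp
  have hsymm : ∀ a : ℝ, gaussianReal 0 v (Set.Iio (-a)) = gaussianReal 0 v (Set.Ioi a) := by
    intro a
    conv_lhs => rw [← neg_zero (G := ℝ), ← gaussianReal_map_neg,
      Measure.map_apply measurable_neg measurableSet_Iio]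
    simp
  have hset : {x : ℝ | c < |x|} = Set.Ioi c ∪ Set.Iio (-c) := by
    ext x
    simp only [Set.mem_ofPred_eq, lt_abs, Set.mem_union, Set.mem_Ioi, Set.mem_Iio]
    constructor <;> rintro (h | h) <;> [left; right; left; right] <;> linarith
  have hone : gaussianReal 0 v (Set.Ioi 0) + gaussianReal 0 v (Set.Ioi 0) ≤ 1 := by
    calc _ = gaussianReal 0 v (Set.Ioi 0) + gaussianReal 0 v (Set.Iio 0) := by
          rw [← hsymm 0, neg_zero]
      _ = gaussianReal 0 v (Set.Ioi 0 ∪ Set.Iio 0) :=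
          (measure_union (Set.disjoint_left.2 fun x (h : 0 < x) (h' : x < 0) => h.not_gt h')
            measurableSet_Iio).symm
      _ ≤ 1 := prob_le_one
  rw [hset]
  calc _ ≤ gaussianReal 0 v (Set.Ioi c) + gaussianReal 0 v (Set.Iio (-c)) := measure_union_le _ _
    _ ≤ ENNReal.ofReal (Real.exp (-b / 2)) *
        (gaussianReal 0 v (Set.Ioi 0) + gaussianReal 0 v (Set.Ioi 0)) := by
        rw [hsymm, mul_add, ← hexp]
        exact add_le_add (gaussianReal_Ioi_le v hv hc0) (gaussianReal_Ioi_le v hv hc0)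
    _ ≤ _ := mul_le_of_le_one_right' hone

/-! ### Information gain and posterior variances -/

section Kernel

variable {X : Type*} {k : X → X → ℝ} {σ : ℝ} {t : ℕ}

theorem posDef_gram_add_noise (hσ : 0 < σ) {x : Fin t → X} (hk : (gram k x).PosSemidef) :
    (gram k x + σ ^ 2 • (1 : Matrix (Fin t) (Fin t) ℝ)).PosDef :=
  Matrix.PosDef.posSemidef_add hk (Matrix.PosDef.one.smul (by positivity))

theorem postVar_le_prior (hσ : 0 < σ) {x : Fin t → X} (hk : (gram k x).PosSemidef) (p : X) :
    postVar k σ x p ≤ k p p := by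
  have h := (posDef_gram_add_noise hσ hk).inv.posSemidef.dotProduct_mulVec_nonneg (crossCov k x p)
  simp only [star_trivial] at h
  rw [postVar]
  linarith

theorem infoGain_eq_log_det (hσ : 0 < σ) {x : Fin t → X} (hk : (gram k x).PosSemidef) :
    infoGain k σ x =
      1 / 2 * (Real.log (gram k x + σ ^ 2 • (1 : Matrix (Fin t) (Fin t) ℝ)).det
        - t * Real.log (σ ^ 2)) := by
  have hdet := (posDef_gram_add_noise hσ hk).det_pos
  have hs : (0 : ℝ) < σ ^ 2 := by positivity
  have : (1 + (σ ^ 2)⁻¹ • gram k x : Matrix (Fin t) (Fin t) ℝ) =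
      (σ ^ 2)⁻¹ • (gram k x + σ ^ 2 • (1 : Matrix (Fin t) (Fin t) ℝ)) := by
    rw [smul_add, smul_smul, inv_mul_cancel₀ hs.ne', one_smul, add_comm]
  rw [infoGain, this, Matrix.det_smul, Real.log_mul (by positivity) hdet.ne', Fintype.card_fin,
    Real.log_pow, Real.log_inv]
  ring

/-- The Schur complement of the block of the first `t` points in the noisy kernel matrix of `t + 1`
points is the predictive variance at the last point plus the noise variance. -/
theorem det_gram_add_noise_succ (hσ : 0 < σ) (hsymm : ∀ p q, k p q = k q p) (x : ℕ → X)
    (hk : (gram k fun i : Fin t => x i).PosSemidef) :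
    (gram k (fun i : Fin (t + 1) => x i) + σ ^ 2 • (1 : Matrix _ _ ℝ)).det =
      (gram k (fun i : Fin t => x i) + σ ^ 2 • (1 : Matrix _ _ ℝ)).det *
        (postVar k σ (fun i : Fin t => x i) (x t) + σ ^ 2) := by
  set M := gram k (fun i : Fin t => x i) + σ ^ 2 • (1 : Matrix (Fin t) (Fin t) ℝ) with hM
  set c := crossCov k (fun i : Fin t => x i) (x t) with hc
  have : Invertible M := (posDef_gram_add_noise hσ hk).isUnit.invertible
  rw [← Matrix.det_submatrix_equiv_self (finSumFinEquiv (m := t) (n := 1))]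
  have hblock : (gram k (fun i : Fin (t + 1) => x i) + σ ^ 2 • (1 : Matrix _ _ ℝ)).submatrix
      (finSumFinEquiv (m := t) (n := 1)) (finSumFinEquiv (m := t) (n := 1)) =
      Matrix.fromBlocks M (Matrix.of fun i _ => c i) (Matrix.of fun _ i => c i)
        (Matrix.of fun _ _ => k (x t) (x t) + σ ^ 2) := by
    ext i j
    rcases i with i | i <;> rcases j with j | j
    · simp [hM, gram, Matrix.one_apply, Fin.ext_iff]
    · simp [hc, gram, crossCov, Fin.ext_iff, i.2.ne]
    · simp [hc, gram, crossCov, Fin.ext_iff, j.2.ne', hsymm (x t)]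
    · simp [gram, Matrix.one_apply, Fin.ext_iff]
  rw [hblock, Matrix.det_fromBlocks₁₁, Matrix.det_fin_one, Matrix.invOf_eq_nonsing_inv]
  congr 1
  have : ((Matrix.of fun (_ : Fin 1) i => c i) * M⁻¹ * (Matrix.of fun i (_ : Fin 1) => c i)) 0 0 =
      c ⬝ᵥ (M⁻¹ *ᵥ c) := by
    rw [Matrix.mul_assoc]
    rfl
  rw [Matrix.sub_apply, this, Matrix.of_apply, postVar]
  ring

/-- The chain rule for the information gain. -/
theorem infoGain_eq_sum (hσ : 0 < σ) (hsymm : ∀ p q, k p q = k q p)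
    (hk : ∀ (t : ℕ) (x : Fin t → X), (gram k x).PosSemidef)
    (hpos : ∀ (t : ℕ) (x : Fin t → X) (p : X), 0 ≤ postVar k σ x p) (x : ℕ → X) (T : ℕ) :
    infoGain k σ (fun i : Fin T => x i) =
      1 / 2 * ∑ t ∈ Finset.range T,
        Real.log (1 + postVar k σ (fun i : Fin t => x i) (x t) / σ ^ 2) := by
  have hs : (0 : ℝ) < σ ^ 2 := by positivity
  induction T with
  | zero => simp [infoGain]
  | succ T ih =>
    rw [Finset.sum_range_succ, mul_add, ← ih, infoGain_eq_log_det hσ (hk _ _),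
      infoGain_eq_log_det hσ (hk _ _), det_gram_add_noise_succ hσ hsymm x (hk _ _)]
    have hv := hpos T (fun i : Fin T => x i) (x T)
    rw [Real.log_mul (posDef_gram_add_noise hσ (hk _ _)).det_pos.ne' (by positivity)]
    have : 1 + postVar k σ (fun i : Fin T => x i) (x T) / σ ^ 2 =
        (postVar k σ (fun i : Fin T => x i) (x T) + σ ^ 2) / σ ^ 2 := by
      field_simp
      ring
    rw [this, Real.log_div (by positivity) hs.ne']
    push_cast
    ring

/-- Since `u / (1 + u) ≤ log (1 + u)`, predictive variances that stay below `B` are dominated by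
their contributions to the information gain. -/
theorem sum_postVar_le (hσ : 0 < σ) (hsymm : ∀ p q, k p q = k q p)
    (hk : ∀ (t : ℕ) (x : Fin t → X), (gram k x).PosSemidef)
    (hpos : ∀ (t : ℕ) (x : Fin t → X) (p : X), 0 ≤ postVar k σ x p)
    {B : ℝ} (hB : ∀ p, k p p ≤ B) (x : ℕ → X) (T : ℕ) :
    ∑ t ∈ Finset.range T, postVar k σ (fun i : Fin t => x i) (x t) ≤
      2 * (σ ^ 2 + B) * infoGain k σ (fun i : Fin T => x i) := by
  have hs : (0 : ℝ) < σ ^ 2 := by positivity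
  rw [infoGain_eq_sum hσ hsymm hk hpos]
  calc _ ≤ ∑ t ∈ Finset.range T,
        (σ ^ 2 + B) * Real.log (1 + postVar k σ (fun i : Fin t => x i) (x t) / σ ^ 2) := by
        refine Finset.sum_le_sum fun t _ => ?_
        set s := postVar k σ (fun i : Fin t => x i) (x t) with hsdef
        have h0 : 0 ≤ s := hpos _ _ _
        have h1 : s ≤ B := (postVar_le_prior hσ (hk _ _) _).trans (hB _)
        have hlog := Real.one_sub_inv_le_log_of_pos (x := 1 + s / σ ^ 2) (by positivity)
        have h2 : s / (σ ^ 2 + s) ≤ Real.log (1 + s / σ ^ 2) := by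
          refine le_trans (le_of_eq ?_) hlog
          field_simp
          ring
        rw [div_le_iff₀ (by positivity)] at h2
        have h3 : 0 ≤ Real.log (1 + s / σ ^ 2) :=
          Real.log_nonneg (by linarith [div_nonneg h0 hs.le])
        nlinarith
    _ = _ := by rw [← Finset.mul_sum]; ring

end Kernel

/-! ### Gaussian observations at fixed points -/

/-- A centred Gaussian process `f` with kernel `k` and a white noise `ε` of variance `σ ^ 2`,
jointly Gaussian and uncorrelated. -/
structure NoisyGP {X Ω : Type*} [MeasurableSpace Ω] (k : X → X → ℝ) (σ : ℝ)
    (f : X → Ω → ℝ) (ε : ℕ → Ω → ℝ) (P : Measure Ω) : Prop where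
  measurable_f : ∀ p, Measurable (f p)
  measurable_noise : ∀ i, Measurable (ε i)
  gaussian : IsGaussianProcess (Sum.elim f ε) P
  mean_f : ∀ p, ∫ ω, f p ω ∂P = 0
  mean_noise : ∀ i, ∫ ω, ε i ω ∂P = 0
  cov_f : ∀ p q, cov[f p, f q; P] = k p q
  cov_noise : ∀ i j, cov[ε i, ε j; P] = if i = j then σ ^ 2 else 0
  cov_f_noise : ∀ p i, cov[f p, ε i; P] = 0

/-- The error at `p` of the predictive mean given the observations `f (x i) + ε i` at the fixed
points `x`. -/
noncomputable def residual {X Ω : Type*} (k : X → X → ℝ) (σ : ℝ) (f : X → Ω → ℝ)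
    (ε : ℕ → Ω → ℝ) {t : ℕ} (x : Fin t → X) (p : X) (ω : Ω) : ℝ :=
  f p ω - postMean k σ x (fun i => f (x i) ω + ε i ω) p

namespace NoisyGP

variable {X Ω : Type*} [MeasurableSpace Ω] {P : Measure Ω}
  {k : X → X → ℝ} {σ : ℝ} {f : X → Ω → ℝ} {ε : ℕ → Ω → ℝ}

theorem memLp_f (h : NoisyGP k σ f ε P) (p : X) : MemLp (f p) 2 P :=
  (h.gaussian.hasGaussianLaw_eval (.inl p)).memLp_two

theorem memLp_noise (h : NoisyGP k σ f ε P) (i : ℕ) : MemLp (ε i) 2 P :=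
  (h.gaussian.hasGaussianLaw_eval (.inr i)).memLp_two

theorem isProbabilityMeasure (h : NoisyGP k σ f ε P) : IsProbabilityMeasure P :=
  h.gaussian.isProbabilityMeasure

theorem memLp_obs (h : NoisyGP k σ f ε P) (p : X) (i : ℕ) :
    MemLp (fun ω => f p ω + ε i ω) 2 P :=
  (h.memLp_f p).add (h.memLp_noise i)

theorem kernel_comm (h : NoisyGP k σ f ε P) (p q : X) : k p q = k q p := by
  rw [← h.cov_f, ← h.cov_f, covariance_comm]

theorem posSemidef_gram (h : NoisyGP k σ f ε P) {t : ℕ} (x : Fin t → X) :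
    (gram k x).PosSemidef := by
  have := h.isProbabilityMeasure
  have hf := h.measurable_f
  refine Matrix.PosSemidef.of_dotProduct_mulVec_nonneg ?_ fun v => ?_
  · ext i j
    simp [gram, h.kernel_comm (x i)]
  · have hv : star v ⬝ᵥ (gram k x *ᵥ v) = Var[fun ω => ∑ i, v i * f (x i) ω; P] := by
      rw [← covariance_self (by fun_prop),
        covariance_fun_sum_fun_sum (fun i => (h.memLp_f _).const_mul _)
          (fun i => (h.memLp_f _).const_mul _)]
      simp only [dotProduct, Matrix.mulVec, gram, Matrix.of_apply, star_trivial,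
        covariance_const_mul_left, covariance_const_mul_right, h.cov_f, Finset.mul_sum]
      exact Finset.sum_congr rfl fun i _ => Finset.sum_congr rfl fun j _ => by ring
    rw [hv]
    exact variance_nonneg _ _

/-- The weights with which the predictive mean combines the observations. -/
noncomputable def weights (k : X → X → ℝ) (σ : ℝ) {t : ℕ} (x : Fin t → X) (p : X) : Fin t → ℝ :=
  (gram k x + σ ^ 2 • (1 : Matrix (Fin t) (Fin t) ℝ))⁻¹ *ᵥ crossCov k x p

theorem isSymm_gram_add_noise (h : NoisyGP k σ f ε P) {t : ℕ} (x : Fin t → X) :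
    (gram k x + σ ^ 2 • (1 : Matrix (Fin t) (Fin t) ℝ)).IsSymm := by
  ext i j
  simp [gram, h.kernel_comm (x i), Matrix.one_apply, eq_comm]

theorem postMean_eq_sum (h : NoisyGP k σ f ε P) {t : ℕ} (x : Fin t → X) (y : Fin t → ℝ) (p : X) :
    postMean k σ x y p = ∑ i, weights k σ x p i * y i := by
  rw [postMean, Matrix.dotProduct_mulVec, ← Matrix.mulVec_transpose, Matrix.transpose_nonsing_inv,
    (h.isSymm_gram_add_noise x).eq]
  rfl

theorem residual_eq (h : NoisyGP k σ f ε P) {t : ℕ} (x : Fin t → X) (p : X) :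
    residual k σ f ε x p =
      fun ω => f p ω - ∑ i, weights k σ x p i * (f (x i) ω + ε i ω) := by
  ext ω
  rw [residual, h.postMean_eq_sum]

theorem measurable_residual (h : NoisyGP k σ f ε P) {t : ℕ} (x : Fin t → X) (p : X) :
    Measurable (residual k σ f ε x p) := by
  have h1 := h.measurable_f
  have h2 := h.measurable_noise
  rw [h.residual_eq]
  fun_prop

theorem memLp_residual (h : NoisyGP k σ f ε P) {t : ℕ} (x : Fin t → X) (p : X) :
    MemLp (residual k σ f ε x p) 2 P := by
  rw [h.residual_eq]
  exact (h.memLp_f p).sub (memLp_finsetSum _ fun i _ => (h.memLp_obs _ _).const_mul _)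

theorem integral_residual (h : NoisyGP k σ f ε P) {t : ℕ} (x : Fin t → X) (p : X) :
    ∫ ω, residual k σ f ε x p ω ∂P = 0 := by
  have := h.isProbabilityMeasure
  have hf := fun p => (h.memLp_f p).integrable one_le_two
  have he := fun i => (h.memLp_noise i).integrable one_le_two
  have ho : ∀ i : Fin t, Integrable (fun ω => weights k σ x p i * (f (x i) ω + ε i ω)) P :=
    fun i => ((hf _).add (he _)).const_mul _
  rw [h.residual_eq, integral_sub (hf p) (integrable_finsetSum _ fun i _ => ho i),
    integral_finsetSum _ fun i _ => ho i]
  simp [integral_const_mul, integral_add (hf _) (he _), h.mean_f, h.mean_noise]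

theorem cov_f_obs (h : NoisyGP k σ f ε P) (p q : X) (i : ℕ) :
    cov[f p, fun ω => f q ω + ε i ω; P] = k p q := by
  have := h.isProbabilityMeasure
  change cov[f p, f q + ε i; P] = _
  rw [covariance_add_right (h.memLp_f p) (h.memLp_f q) (h.memLp_noise i), h.cov_f, h.cov_f_noise,
    add_zero]

theorem cov_noise_obs (h : NoisyGP k σ f ε P) (q : X) (i j : ℕ) :
    cov[ε i, fun ω => f q ω + ε j ω; P] = if i = j then σ ^ 2 else 0 := by
  have := h.isProbabilityMeasure
  change cov[ε i, f q + ε j; P] = _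
  rw [covariance_add_right (h.memLp_noise i) (h.memLp_f q) (h.memLp_noise j), h.cov_noise,
    covariance_comm, h.cov_f_noise, zero_add]

theorem cov_obs_obs (h : NoisyGP k σ f ε P) {t : ℕ} (x : Fin t → X) (i j : Fin t) :
    cov[fun ω => f (x i) ω + ε i ω, fun ω => f (x j) ω + ε j ω; P] =
      (gram k x + σ ^ 2 • (1 : Matrix (Fin t) (Fin t) ℝ)) i j := by
  have := h.isProbabilityMeasure
  change cov[f (x i) + ε i, fun ω => f (x j) ω + ε j ω; P] = _
  rw [covariance_add_left (h.memLp_f _) (h.memLp_noise _) (h.memLp_obs _ _), h.cov_f_obs,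
    h.cov_noise_obs]
  simp [gram, Matrix.one_apply, Fin.ext_iff]

theorem cov_sum_weights_obs (hσ : 0 < σ) (h : NoisyGP k σ f ε P) {t : ℕ} (x : Fin t → X) (p : X)
    (j : Fin t) :
    cov[fun ω => ∑ i, weights k σ x p i * (f (x i) ω + ε i ω),
      fun ω => f (x j) ω + ε j ω; P] = k p (x j) := by
  have := h.isProbabilityMeasure
  rw [covariance_fun_sum_left (fun i => (h.memLp_obs _ _).const_mul _) (h.memLp_obs _ _)]
  simp only [covariance_const_mul_left, h.cov_obs_obs]
  have hM := (posDef_gram_add_noise hσ (h.posSemidef_gram x)).isUnit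
  have : (gram k x + σ ^ 2 • (1 : Matrix (Fin t) (Fin t) ℝ)) *ᵥ weights k σ x p =
      crossCov k x p := by
    rw [weights, Matrix.mulVec_mulVec, Matrix.mul_nonsing_inv _
      ((Matrix.isUnit_iff_isUnit_det _).1 hM), Matrix.one_mulVec]
  have hj := congrFun this j
  rw [crossCov, h.kernel_comm] at hj
  rw [← hj, Matrix.mulVec, dotProduct]
  refine Finset.sum_congr rfl fun i _ => ?_
  rw [(h.isSymm_gram_add_noise x).apply, mul_comm]

/-- The normal equations: the prediction error is uncorrelated with the data. -/
theorem cov_residual_obs (hσ : 0 < σ) (h : NoisyGP k σ f ε P) {t : ℕ} (x : Fin t → X) (p : X)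
    (j : Fin t) :
    cov[residual k σ f ε x p, fun ω => f (x j) ω + ε j ω; P] = 0 := by
  have := h.isProbabilityMeasure
  rw [h.residual_eq, covariance_fun_sub_left (h.memLp_f p)
    (memLp_finsetSum _ fun i _ => (h.memLp_obs _ _).const_mul _) (h.memLp_obs _ _),
    h.cov_sum_weights_obs hσ, h.cov_f_obs, sub_self]

theorem variance_residual (hσ : 0 < σ) (h : NoisyGP k σ f ε P) {t : ℕ} (x : Fin t → X) (p : X) :
    Var[residual k σ f ε x p; P] = postVar k σ x p := by
  have := h.isProbabilityMeasure
  have hsum : MemLp (fun ω => ∑ i, weights k σ x p i * (f (x i) ω + ε i ω)) 2 P :=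
    memLp_finsetSum _ fun i _ => (h.memLp_obs _ _).const_mul _
  rw [← covariance_self (h.measurable_residual x p).aemeasurable]
  conv_lhs => arg 1; rw [h.residual_eq]
  rw [covariance_fun_sub_left (h.memLp_f p) hsum (h.memLp_residual x p),
    covariance_fun_sum_left (fun i => (h.memLp_obs _ _).const_mul _) (h.memLp_residual x p)]
  simp only [covariance_const_mul_left]
  simp only [covariance_comm _ (residual k σ f ε x p), h.cov_residual_obs hσ]
  rw [h.residual_eq, covariance_comm, covariance_fun_sub_right (h.memLp_f p) (h.memLp_f p) hsum,
    covariance_fun_sum_right (fun i => (h.memLp_obs _ _).const_mul _) (h.memLp_f p)]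
  simp only [covariance_const_mul_right, h.cov_f_obs, h.cov_f]
  simp [postVar, dotProduct, weights, crossCov, h.kernel_comm p, mul_comm]

theorem postVar_nonneg (hσ : 0 < σ) (h : NoisyGP k σ f ε P) {t : ℕ} (x : Fin t → X) (p : X) :
    0 ≤ postVar k σ x p :=
  h.variance_residual hσ x p ▸ variance_nonneg _ _

/-- Prediction error and data are jointly Gaussian. -/
theorem isGaussianProcess_residual_obs (h : NoisyGP k σ f ε P) {t : ℕ} (x : Fin t → X) (p : X) :
    IsGaussianProcess (Sum.elim (fun _ : Unit => residual k σ f ε x p)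
      (fun (i : Fin t) ω => f (x i) ω + ε i ω)) P := by
  classical
  refine IsGaussianProcess.of_isGaussianProcess h.gaussian ?_
  rintro (_ | i)
  · let I : Finset (X ⊕ ℕ) := insert (.inl p)
      (Finset.univ.image (fun i : Fin t => .inl (x i)) ∪
        Finset.univ.image (fun i : Fin t => .inr (i : ℕ)))
    have h1 : ∀ i : Fin t, (.inl (x i) : X ⊕ ℕ) ∈ I := fun i => by simp [I]
    have h2 : ∀ i : Fin t, (.inr (i : ℕ) : X ⊕ ℕ) ∈ I := fun i => by simp [I]
    let e : I → (I → ℝ) →L[ℝ] ℝ := fun i => ContinuousLinearMap.proj (R := ℝ) (φ := fun _ => ℝ) i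
    refine ⟨I, e ⟨.inl p, by simp [I]⟩ -
      ∑ i : Fin t, weights k σ x p i • (e ⟨_, h1 i⟩ + e ⟨_, h2 i⟩), fun ω => ?_⟩
    simp [h.residual_eq, e, mul_add]
  · let I : Finset (X ⊕ ℕ) := {.inl (x i), .inr (i : ℕ)}
    let e : I → (I → ℝ) →L[ℝ] ℝ := fun i => ContinuousLinearMap.proj (R := ℝ) (φ := fun _ => ℝ) i
    exact ⟨I, e ⟨.inl (x i), by simp [I]⟩ + e ⟨.inr (i : ℕ), by simp [I]⟩, fun ω => by simp [e]⟩

theorem indepFun_obs_residual (hσ : 0 < σ) (h : NoisyGP k σ f ε P) {t : ℕ} (x : Fin t → X)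
    (p : X) :
    IndepFun (fun ω (i : Fin t) => f (x i) ω + ε i ω) (residual k σ f ε x p) P := by
  have h1 := h.measurable_f
  have h2 := h.measurable_noise
  have := (h.isGaussianProcess_residual_obs x p).indepFun_of_covariance_eq_zero
    (fun _ => (h.measurable_residual x p).aemeasurable)
    (fun i => by fun_prop) (fun _ j => h.cov_residual_obs hσ x p j)
  exact this.symm.comp measurable_id (measurable_pi_apply ())

theorem map_residual (hσ : 0 < σ) (h : NoisyGP k σ f ε P) {t : ℕ} (x : Fin t → X) (p : X) :
    P.map (residual k σ f ε x p) = gaussianReal 0 (postVar k σ x p).toNNReal := by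
  have hg : HasGaussianLaw (residual k σ f ε x p) P :=
    (h.isGaussianProcess_residual_obs x p).hasGaussianLaw_eval (.inl ())
  rw [hg.map_eq_gaussianReal, h.integral_residual, h.variance_residual hσ]

theorem measure_residual_le (hσ : 0 < σ) (h : NoisyGP k σ f ε P) {t : ℕ} (x : Fin t → X) (p : X)
    {b : ℝ} (hb : 0 ≤ b) :
    P {ω | √b * √(postVar k σ x p) < |residual k σ f ε x p ω|} ≤
      ENNReal.ofReal (Real.exp (-b / 2)) := by
  have := gaussianReal_abs_gt_le (postVar k σ x p).toNNReal hb
  rw [Real.coe_toNNReal _ (h.postVar_nonneg hσ x p), ← h.map_residual hσ, Measure.map_apply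
    (h.measurable_residual x p)
    (measurableSet_lt measurable_const continuous_abs.measurable)] at this
  exact this

/-! ### Adaptive queries -/

/-- The confidence bound survives adaptive queries. On the event that the first `t` queries are
`x`, the data are the observations at the fixed points `x`, and this event is determined by these
observations, hence independent of the prediction error they leave at `p`. Only finitely many `x`
are possible, and their events are disjoint. -/
theorem measure_adaptive_le [Fintype X] [MeasurableSpace X] [MeasurableSingletonClass X]
    (hσ : 0 < σ) (h : NoisyGP k σ f ε P) {c : ℕ → ℝ} {z : ℕ → Ω → X}
    (hz : IsGPUCBRun k σ c f ε z) (t : ℕ) (p : X) {b : ℝ} (hb : 0 ≤ b) :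
    P {ω | √b * √(postVar k σ (fun i : Fin t => z i ω) p) <
        |f p ω - postMean k σ (fun i : Fin t => z i ω) (fun i : Fin t => obs f ε z i ω) p|} ≤
      ENNReal.ofReal (Real.exp (-b / 2)) := by
  have := h.isProbabilityMeasure
  choose rule hrule hzrule using hz.history_dependent
  -- `D x` is the set of data vectors at the points `x` for which the rule selects exactly `x`.
  let D : (Fin t → X) → Set (Fin t → ℝ) := fun x =>
    {y | ∀ i : Fin t, rule i (fun j : Fin i =>
      (x ⟨j, j.2.trans i.2⟩, y ⟨j, j.2.trans i.2⟩)) = x i}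
  let Y : (Fin t → X) → Ω → Fin t → ℝ := fun x ω i => f (x i) ω + ε i ω
  have hY : ∀ x, Measurable (Y x) := fun x =>
    measurable_pi_lambda _ fun i => (h.measurable_f _).add (h.measurable_noise _)
  have hD : ∀ x, MeasurableSet (D x) := by
    intro x
    have : D x = ⋂ i : Fin t, (fun y : Fin t → ℝ => rule i (fun j : Fin i =>
      (x ⟨j, j.2.trans i.2⟩, y ⟨j, j.2.trans i.2⟩))) ⁻¹' {x i} := by
      ext y; simp [D]
    rw [this]
    refine MeasurableSet.iInter fun i => ((hrule i).comp ?_) (measurableSet_singleton _)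
    fun_prop
  have hmem : ∀ x ω, Y x ω ∈ D x ↔ (fun i : Fin t => z i ω) = x := by
    intro x ω
    constructor
    · intro hy
      have key : ∀ n (hn : n < t), z n ω = x ⟨n, hn⟩ := by
        intro n
        induction n using Nat.strong_induction_on with
        | _ n ih =>
          intro hn
          rw [hzrule n ω, ← hy ⟨n, hn⟩]
          congr 1
          ext1 j
          simp only [obs, ih j j.2 (j.2.trans hn), Y]
      exact funext fun i => key i i.2
    · rintro rfl i
      exact (hzrule i ω).symm
  have hdisj : Pairwise (Function.onFun Disjoint fun x => Y x ⁻¹' D x) := by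
    intro x x' hxx'
    refine Set.disjoint_left.2 fun ω h1 h2 => hxx' ?_
    rw [← (hmem x ω).1 h1, ← (hmem x' ω).1 h2]
  calc _ ≤ P (⋃ x, (Y x ⁻¹' D x) ∩
        residual k σ f ε x p ⁻¹' {r | √b * √(postVar k σ x p) < |r|}) := by
        refine measure_mono fun ω hω => Set.mem_iUnion.2 ⟨fun i => z i ω, ?_, ?_⟩
        · exact (hmem _ ω).2 rfl
        · exact hω
    _ ≤ ∑ x, P ((Y x ⁻¹' D x) ∩
        residual k σ f ε x p ⁻¹' {r | √b * √(postVar k σ x p) < |r|}) :=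
        measure_iUnion_fintype_le _ _
    _ ≤ ∑ x, P (Y x ⁻¹' D x) * ENNReal.ofReal (Real.exp (-b / 2)) := by
        refine Finset.sum_le_sum fun x _ => ?_
        rw [(h.indepFun_obs_residual hσ x p).measure_inter_preimage_eq_mul _ _ (hD x)
          (measurableSet_lt measurable_const continuous_abs.measurable)]
        gcongr
        exact h.measure_residual_le hσ x p hb
    _ = P (⋃ x, Y x ⁻¹' D x) * ENNReal.ofReal (Real.exp (-b / 2)) := by
        rw [← Finset.sum_mul, measure_iUnion hdisj (fun x => hY x (hD x)), tsum_fintype]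
    _ ≤ _ := mul_le_of_le_one_left' prob_le_one

end NoisyGP

/-! ### Joint Gaussianity of independent Gaussian processes -/

theorem isGaussianProcess_of_iIndepFun {ι Ω : Type*} [MeasurableSpace Ω] {P : Measure Ω}
    {ε : ι → Ω → ℝ} (hε : ∀ i, HasGaussianLaw (ε i) P) (hind : iIndepFun ε P) :
    IsGaussianProcess ε P where
  hasGaussianLaw I :=
    iIndepFun.hasGaussianLaw (X := fun i : I => ε i) (fun i => hε i)
      (hind.precomp Subtype.val_injective)

theorem isGaussianProcess_sumElim_of_indepFun {S T Ω : Type*} [MeasurableSpace Ω] {P : Measure Ω}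
    {X : S → Ω → ℝ} {Y : T → Ω → ℝ} (hX : IsGaussianProcess X P) (hY : IsGaussianProcess Y P)
    (hXY : IndepFun (fun ω s => X s ω) (fun ω t => Y t ω) P) :
    IsGaussianProcess (Sum.elim X Y) P where
  hasGaussianLaw I := by
    have hpair : HasGaussianLaw (fun ω =>
        (I.toLeft.restrict (X · ω), I.toRight.restrict (Y · ω))) P :=
      (hXY.comp (I.toLeft.measurable_restrict) (I.toRight.measurable_restrict)).hasGaussianLaw
        (hX.hasGaussianLaw I.toLeft) (hY.hasGaussianLaw I.toRight)
    let L : (I.toLeft → ℝ) × (I.toRight → ℝ) →ₗ[ℝ] (I → ℝ) :=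
      { toFun := fun u i => match i with
          | ⟨.inl s, hs⟩ => u.1 ⟨s, Finset.mem_toLeft.2 hs⟩
          | ⟨.inr t, ht⟩ => u.2 ⟨t, Finset.mem_toRight.2 ht⟩
        map_add' := fun u v => by
          ext ⟨i | i, hi⟩ <;> rfl
        map_smul' := fun c u => by
          ext ⟨i | i, hi⟩ <;> rfl }
    have heq : (fun ω => I.restrict (Sum.elim X Y · ω)) = LinearMap.toContinuousLinearMap L ∘
        fun ω => (I.toLeft.restrict (X · ω), I.toRight.restrict (Y · ω)) := by
      funext ω i
      rcases i with ⟨i | i, hi⟩ <;> rfl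
    rw [heq]
    exact hpair.map (LinearMap.toContinuousLinearMap L)

theorem noisyGP_of_indepFun {X Ω : Type*} [MeasurableSpace Ω] {P : Measure Ω}
    [IsProbabilityMeasure P] {k : X → X → ℝ} {σ : ℝ} {f : X → Ω → ℝ} {ε : ℕ → Ω → ℝ}
    (hfm : ∀ p, Measurable (f p)) (hf : IsGaussianProcess f P)
    (hf0 : ∀ p, ∫ ω, f p ω ∂P = 0) (hk : ∀ p q, cov[f p, f q; P] = k p q)
    (hεm : ∀ i, Measurable (ε i))
    (hε : ∀ i, HasLaw (ε i) (gaussianReal 0 (Real.toNNReal (σ ^ 2))) P)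
    (hεind : iIndepFun ε P) (hfε : IndepFun (fun ω p => f p ω) (fun ω i => ε i ω) P) :
    NoisyGP k σ f ε P where
  measurable_f := hfm
  measurable_noise := hεm
  gaussian := isGaussianProcess_sumElim_of_indepFun hf
    (isGaussianProcess_of_iIndepFun (fun i => (hε i).hasGaussianLaw) hεind) hfε
  mean_f := hf0
  mean_noise i := by rw [(hε i).integral_eq, integral_id_gaussianReal]
  cov_f := hk
  cov_noise i j := by
    split_ifs with h
    · subst h
      rw [covariance_self (hεm i).aemeasurable, (hε i).variance_eq, variance_id_gaussianReal,
        Real.coe_toNNReal _ (sq_nonneg σ)]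
    · exact (hεind.indepFun h).covariance_eq_zero (hε i).hasGaussianLaw.memLp_two
        (hε j).hasGaussianLaw.memLp_two
  cov_f_noise p i :=
    (hfε.comp (measurable_pi_apply p) (measurable_pi_apply i)).covariance_eq_zero
      (hf.hasGaussianLaw_eval p).memLp_two (hε i).hasGaussianLaw.memLp_two

/-- Points that the kernel does not distinguish carry almost surely equal values. -/
theorem NoisyGP.ae_eq_of_kernel_eq {X Ω : Type*} [MeasurableSpace Ω] {P : Measure Ω}
    {k : X → X → ℝ} {σ : ℝ} {f : X → Ω → ℝ} {ε : ℕ → Ω → ℝ} (h : NoisyGP k σ f ε P) {p q : X}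
    (hpq : k p q = k p p) (hqq : k q q = k p p) : ∀ᵐ ω ∂P, f p ω = f q ω := by
  have := h.isProbabilityMeasure
  have hvar : Var[f p - f q; P] = 0 := by
    rw [variance_sub (h.memLp_f p) (h.memLp_f q),
      ← covariance_self (h.measurable_f p).aemeasurable,
      ← covariance_self (h.measurable_f q).aemeasurable, h.cov_f, h.cov_f, h.cov_f, hpq, hqq]
    ring
  have hmean : ∫ ω, (f p - f q) ω ∂P = 0 := by
    simp only [Pi.sub_apply]
    rw [integral_sub ((h.memLp_f p).integrable one_le_two) ((h.memLp_f q).integrable one_le_two),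
      h.mean_f, h.mean_f, sub_zero]
  filter_upwards [ae_eq_integral_of_variance_eq_zero ((h.memLp_f p).sub (h.memLp_f q)) hvar]
    with ω hω
  rw [hmean] at hω
  exact sub_eq_zero.1 hω

/-! ### From confidence bounds to regret -/

/-- If the confidence bounds hold in every round, the regret of a round is at most twice the width
of the bound at the query; Cauchy–Schwarz and the information gain bound the sum. -/
theorem sum_regret_le {X : Type*} [Nonempty X] {k : X → X → ℝ} {σ B : ℝ} (hσ : 0 < σ)
    (hsymm : ∀ p q, k p q = k q p) (hk : ∀ (t : ℕ) (x : Fin t → X), (gram k x).PosSemidef)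
    (hpos : ∀ (t : ℕ) (x : Fin t → X) (p : X), 0 ≤ postVar k σ x p) (hB : ∀ p, k p p ≤ B)
    {b : ℕ → ℝ} {g : X → ℝ} {x : ℕ → X} {y : ℕ → ℝ} {T : ℕ} {β : ℝ}
    (hb : ∀ t < T, b (t + 1) ≤ β)
    (hconf : ∀ t < T, ∀ p, |g p - postMean k σ (fun i : Fin t => x i) (fun i => y i) p| ≤
      √(b (t + 1)) * √(postVar k σ (fun i : Fin t => x i) p))
    (hmax : ∀ t < T, ∀ p, ucb k σ (b (t + 1)) (fun i : Fin t => x i) (fun i => y i) p ≤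
      ucb k σ (b (t + 1)) (fun i : Fin t => x i) (fun i => y i) (x t)) :
    ∑ t ∈ Finset.range T, ((⨆ p, g p) - g (x t)) ≤
      2 * √β * √(T * (2 * (σ ^ 2 + B) * infoGain k σ (fun i : Fin T => x i))) := by
  set s : ℕ → ℝ := fun t => postVar k σ (fun i : Fin t => x i) (x t) with hs
  have hround : ∀ t ∈ Finset.range T, (⨆ p, g p) - g (x t) ≤ 2 * √β * (√1 * √(s t)) := by
    intro t ht
    have ht := Finset.mem_range.1 ht
    have hlow := (abs_le.1 (hconf t ht (x t))).1
    have hsup : (⨆ p, g p) ≤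
        ucb k σ (b (t + 1)) (fun i : Fin t => x i) (fun i => y i) (x t) := by
      refine ciSup_le fun p => le_trans ?_ (hmax t ht p)
      have := (abs_le.1 (hconf t ht p)).2
      rw [ucb]
      linarith
    have hβ : √(b (t + 1)) * √(s t) ≤ √β * √(s t) := by
      gcongr
      exact hb t ht
    rw [ucb] at hsup
    rw [Real.sqrt_one]
    linarith
  calc _ ≤ ∑ t ∈ Finset.range T, 2 * √β * (√1 * √(s t)) := Finset.sum_le_sum hround
    _ = 2 * √β * ∑ t ∈ Finset.range T, √1 * √(s t) := by rw [Finset.mul_sum]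
    _ ≤ 2 * √β * (√(∑ t ∈ Finset.range T, 1) * √(∑ t ∈ Finset.range T, s t)) := by
        gcongr
        exact Real.sum_sqrt_mul_sqrt_le _ (fun _ => zero_le_one) (fun t => hpos _ _ _)
    _ ≤ _ := by
        rw [Real.sqrt_mul (Nat.cast_nonneg T)]
        simp only [Finset.sum_const, Finset.card_range, nsmul_eq_mul, mul_one]
        gcongr
        exact sum_postVar_le hσ hsymm hk hpos hB x T

/-! ### The embedded space and the confidence parameter -/

section Embedding

variable {m d : ℕ} (A : Fin m → Fin d → Bool)

theorem finite_embeddedSpace : (embeddedSpace A).Finite := Set.finite_range _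

theorem ncard_embeddedSpace_pos : 0 < (embeddedSpace A).ncard :=
  (Set.ncard_pos (finite_embeddedSpace A)).2 (Set.range_nonempty _)

/-- Each of the `m` coordinates of the embedding takes one of the values `0, …, d`. -/
theorem ncard_embeddedSpace_le : (embeddedSpace A).ncard ≤ (d + 1) ^ m := by
  have hsub : embeddedSpace A ⊆
      Set.range (fun (u : Fin m → Fin (d + 1)) (i : Fin m) => ((u i : ℕ) : ℝ)) := by
    rintro _ ⟨z, rfl⟩
    refine ⟨fun i => ⟨hammingDist (A i) z, ?_⟩, rfl⟩
    exact Nat.lt_succ_of_le (by simpa using hammingDist_le_card_fintype (x := A i) (y := z))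
  calc _ ≤ _ := Set.ncard_le_ncard hsub (Set.finite_range _)
    _ ≤ Nat.card (Fin m → Fin (d + 1)) := by
        rw [← Nat.card_coe_set_eq]
        exact Finite.card_range_le _
    _ = _ := by simp

theorem infoGain_le_maxInfoGain (kbase : (Fin m → ℝ) → (Fin m → ℝ) → ℝ) (σ : ℝ) {T : ℕ}
    (x : Fin T → Fin d → Bool) :
    infoGain (dictKernel A kbase) σ x ≤ maxInfoGain kbase σ (embeddedSpace A) T := by
  have := (finite_embeddedSpace A).to_subtype
  exact le_ciSup
    (f := fun u : Fin T → embeddedSpace A => infoGain kbase σ fun i => (u i : Fin m → ℝ))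
    (Set.finite_range _).bddAbove (fun i => ⟨embed A (x i), x i, rfl⟩)

variable {δ : ℝ}

theorem one_le_beta_arg (hδ : 0 < δ) (hδ1 : δ < 1) {t : ℕ} (ht : 1 ≤ t) :
    1 ≤ (embeddedSpace A).ncard * (t : ℝ) ^ 2 * Real.pi ^ 2 / (6 * δ) := by
  rw [le_div_iff₀ (by positivity)]
  have h1 : (1 : ℝ) ≤ (embeddedSpace A).ncard := by
    exact_mod_cast ncard_embeddedSpace_pos A
  have h2 : (1 : ℝ) ≤ (t : ℝ) ^ 2 := one_le_pow₀ (by exact_mod_cast ht)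
  have h3 : (9 : ℝ) ≤ Real.pi ^ 2 := by nlinarith [Real.pi_gt_three]
  have h4 : (1 : ℝ) ≤ (embeddedSpace A).ncard * (t : ℝ) ^ 2 := one_le_mul_of_one_le_of_one_le h1 h2
  nlinarith

theorem beta_nonneg (hδ : 0 < δ) (hδ1 : δ < 1) {t : ℕ} (ht : 1 ≤ t) : 0 ≤ beta A δ t :=
  mul_nonneg two_pos.le (Real.log_nonneg (one_le_beta_arg A hδ hδ1 ht))

theorem exp_neg_half_beta (hδ : 0 < δ) (hδ1 : δ < 1) {t : ℕ} (ht : 1 ≤ t) :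
    (embeddedSpace A).ncard * Real.exp (-beta A δ t / 2) =
      6 * δ / Real.pi ^ 2 * (1 / (t : ℝ) ^ 2) := by
  have harg := one_le_beta_arg A hδ hδ1 ht
  have h1 : (0 : ℝ) < (embeddedSpace A).ncard := by exact_mod_cast ncard_embeddedSpace_pos A
  have h2 : (0 : ℝ) < t := by exact_mod_cast ht
  rw [beta, neg_div, mul_div_cancel_left₀ _ two_ne_zero, Real.exp_neg,
    Real.exp_log (one_pos.trans_le harg)]
  have := Real.pi_pos
  field_simp

theorem beta_mono (hδ : 0 < δ) (hδ1 : δ < 1) {s t : ℕ} (hs : 1 ≤ s) (hst : s ≤ t) :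
    beta A δ s ≤ beta A δ t := by
  have := one_pos.trans_le (one_le_beta_arg A hδ hδ1 hs)
  unfold beta
  gcongr

/-- As `|S_A| ≤ (d + 1) ^ m`, the confidence parameter is of order `m`, up to logarithms. -/
theorem beta_le (hδ : 0 < δ) (hδ1 : δ < 1) (hm : 1 ≤ m) {t : ℕ} (ht : 1 ≤ t) :
    beta A δ t ≤
      4 * (m * (1 + Real.log t + Real.log (d + 1) + Real.log (1 / δ))) := by
  have hN : (0 : ℝ) < (embeddedSpace A).ncard := by exact_mod_cast ncard_embeddedSpace_pos A
  have ht' : (1 : ℝ) ≤ t := by exact_mod_cast ht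
  have hm' : (1 : ℝ) ≤ m := by exact_mod_cast hm
  have hcard : Real.log (embeddedSpace A).ncard ≤ m * Real.log (d + 1) := by
    rw [← Real.log_pow]
    refine Real.log_le_log hN ?_
    exact_mod_cast ncard_embeddedSpace_le A
  have hpi : Real.log (Real.pi ^ 2 / 6) ≤ 1 := by
    refine (Real.log_le_sub_one_of_pos (by positivity)).trans ?_
    nlinarith [Real.pi_lt_d2, Real.pi_pos]
  have hsplit : Real.log ((embeddedSpace A).ncard * (t : ℝ) ^ 2 * Real.pi ^ 2 / (6 * δ)) =
      Real.log (embeddedSpace A).ncard + 2 * Real.log t + Real.log (Real.pi ^ 2 / 6) +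
        Real.log (1 / δ) := by
    have hpi0 : Real.pi ≠ 0 := Real.pi_ne_zero
    rw [show (embeddedSpace A).ncard * (t : ℝ) ^ 2 * Real.pi ^ 2 / (6 * δ) =
        (embeddedSpace A).ncard * (t : ℝ) ^ 2 * (Real.pi ^ 2 / 6) * (1 / δ) by ring,
      Real.log_mul (by positivity) (by positivity), Real.log_mul (by positivity) (by positivity),
      Real.log_mul (by positivity) (by positivity), Real.log_pow]
    push_cast
    ring
  have hlt : 0 ≤ Real.log t := Real.log_nonneg ht'
  have hld : 0 ≤ Real.log ((d : ℝ) + 1) :=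
    Real.log_nonneg (by linarith [Nat.cast_nonneg (α := ℝ) d])
  have hlδ : 0 ≤ Real.log (1 / δ) := Real.log_nonneg (by rw [le_div_iff₀ hδ]; linarith)
  rw [beta, hsplit]
  have h1 : Real.log t ≤ m * Real.log t := le_mul_of_one_le_left hlt hm'
  have h2 : Real.log (1 / δ) ≤ m * Real.log (1 / δ) := le_mul_of_one_le_left hlδ hm'
  have h3 : 0 ≤ m * Real.log ((d : ℝ) + 1) := by positivity
  linarith

end Embedding

/-! ### The union bound over rounds and embedded points -/

section Dictionary

variable {m d : ℕ} {A : Fin m → Fin d → Bool} {kbase : (Fin m → ℝ) → (Fin m → ℝ) → ℝ}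
  {σ δ : ℝ}

theorem crossCov_dictKernel_congr {t : ℕ} (x : Fin t → Fin d → Bool)
    {p q : Fin d → Bool} (hpq : embed A p = embed A q) :
    crossCov (dictKernel A kbase) x p = crossCov (dictKernel A kbase) x q := by
  ext i
  simp only [crossCov, dictKernel, hpq]

theorem postMean_dictKernel_congr {t : ℕ} (x : Fin t → Fin d → Bool) (y : Fin t → ℝ)
    {p q : Fin d → Bool} (hpq : embed A p = embed A q) :
    postMean (dictKernel A kbase) σ x y p = postMean (dictKernel A kbase) σ x y q := by
  rw [postMean, crossCov_dictKernel_congr x hpq, postMean]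

theorem postVar_dictKernel_congr {t : ℕ} (x : Fin t → Fin d → Bool)
    {p q : Fin d → Bool} (hpq : embed A p = embed A q) :
    postVar (dictKernel A kbase) σ x p = postVar (dictKernel A kbase) σ x q := by
  rw [postVar, crossCov_dictKernel_congr x hpq, postVar]
  simp only [dictKernel, hpq]

variable {Ω : Type*} [MeasurableSpace Ω] {P : Measure Ω} {f : (Fin d → Bool) → Ω → ℝ}
  {ε : ℕ → Ω → ℝ} {z : ℕ → Ω → Fin d → Bool}

/-- The choice of `β_t` makes the failure probabilities sum to `δ`, by `∑ 1 / t² = π² / 6`. -/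
theorem tsum_exp_neg_half_beta (A : Fin m → Fin d → Bool) [Fintype (embeddedSpace A)]
    (hδ : 0 < δ) (hδ1 : δ < 1) :
    ∑' t : ℕ, ∑ _s : embeddedSpace A, ENNReal.ofReal (Real.exp (-beta A δ (t + 1) / 2)) =
      ENNReal.ofReal δ := by
  have hsum : HasSum (fun t : ℕ => 6 * δ / Real.pi ^ 2 * (1 / ((t + 1 : ℕ) : ℝ) ^ 2)) δ := by
    have h := ((hasSum_nat_add_iff' 1).2 hasSum_zeta_two).mul_left (6 * δ / Real.pi ^ 2)
    have hπ := Real.pi_ne_zero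
    have e : 6 * δ / Real.pi ^ 2 *
        (Real.pi ^ 2 / 6 - ∑ i ∈ Finset.range 1, (1 : ℝ) / (i : ℝ) ^ 2) = δ := by
      simp
      field_simp
    rwa [e] at h
  conv_rhs => rw [← hsum.tsum_eq,
    ENNReal.ofReal_tsum_of_nonneg (fun t => by positivity) hsum.summable]
  refine tsum_congr fun t => ?_
  rw [← exp_neg_half_beta A hδ hδ1 (Nat.le_add_left 1 t), Finset.sum_const, nsmul_eq_mul,
    Finset.card_univ, ← Nat.card_eq_fintype_card, Nat.card_coe_set_eq,
    ENNReal.ofReal_mul (Nat.cast_nonneg _), ENNReal.ofReal_natCast]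

/-- With probability at least `1 - δ` all confidence bounds hold, at all points and in all rounds.
The union bound runs over one representative of each embedded point only: points with the same
embedding have the same predictions and, almost surely, the same value of `f`. -/
theorem measure_confidence_ge (hσ : 0 < σ) (hδ : 0 < δ) (hδ1 : δ < 1)
    (h : NoisyGP (dictKernel A kbase) σ f ε P)
    (hz : IsGPUCBRun (dictKernel A kbase) σ (beta A δ) f ε z) :
    ENNReal.ofReal (1 - δ) ≤
      P {ω | (∀ p q, embed A p = embed A q → f p ω = f q ω) ∧ ∀ (t : ℕ) (p : Fin d → Bool),
        |f p ω - postMean (dictKernel A kbase) σ (fun i : Fin t => z i ω)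
            (fun i => obs f ε z i ω) p| ≤
          √(beta A δ (t + 1)) * √(postVar (dictKernel A kbase) σ (fun i : Fin t => z i ω) p)} := by
  have := h.isProbabilityMeasure
  have hfin := (finite_embeddedSpace A).fintype
  choose r hr using fun s : embeddedSpace A => s.2
  set N : Set Ω := {ω | ¬ ∀ p q, embed A p = embed A q → f p ω = f q ω} with hN
  set E : ℕ → embeddedSpace A → Set Ω := fun t s =>
    {ω | √(beta A δ (t + 1)) * √(postVar (dictKernel A kbase) σ (fun i : Fin t => z i ω) (r s)) <
      |f (r s) ω - postMean (dictKernel A kbase) σ (fun i : Fin t => z i ω)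
        (fun i => obs f ε z i ω) (r s)|} with hE
  set G : Set Ω := {ω | (∀ p q, embed A p = embed A q → f p ω = f q ω) ∧
    ∀ (t : ℕ) (p : Fin d → Bool),
      |f p ω - postMean (dictKernel A kbase) σ (fun i : Fin t => z i ω)
          (fun i => obs f ε z i ω) p| ≤
        √(beta A δ (t + 1)) * √(postVar (dictKernel A kbase) σ (fun i : Fin t => z i ω) p)} with hG
  have hN0 : P N = 0 := by
    refine (ae_iff (p := fun ω => ∀ p q, embed A p = embed A q → f p ω = f q ω)).1 ?_
    refine ae_all_iff.2 fun p => ae_all_iff.2 fun q => ?_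
    by_cases hpq : embed A p = embed A q
    · have := h.ae_eq_of_kernel_eq (p := p) (q := q) (by simp [dictKernel, hpq])
        (by simp [dictKernel, hpq])
      filter_upwards [this] with ω hω _ using hω
    · exact Filter.Eventually.of_forall fun ω hpq' => absurd hpq' hpq
  have hcover : Set.univ ⊆ G ∪ (N ∪ ⋃ t, ⋃ s, E t s) := by
    intro ω _
    by_contra hω
    simp only [Set.mem_union, not_or, Set.mem_iUnion, not_exists] at hω
    obtain ⟨hωG, hωN, hωE⟩ := hω
    have hf : ∀ p q, embed A p = embed A q → f p ω = f q ω := not_not.1 hωN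
    refine hωG ⟨hf, fun t p => ?_⟩
    have hp : embed A p = embed A (r ⟨embed A p, p, rfl⟩) := (hr ⟨embed A p, p, rfl⟩).symm
    rw [hf _ _ hp, postMean_dictKernel_congr _ _ hp, postVar_dictKernel_congr _ hp]
    exact not_lt.1 (hωE t ⟨embed A p, p, rfl⟩)
  have hbad : P (N ∪ ⋃ t, ⋃ s, E t s) ≤ ENNReal.ofReal δ := by
    calc _ ≤ P N + P (⋃ t, ⋃ s, E t s) := measure_union_le _ _
      _ = P (⋃ t, ⋃ s, E t s) := by rw [hN0, zero_add]
      _ ≤ ∑' t, P (⋃ s, E t s) := measure_iUnion_le _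
      _ ≤ ∑' t : ℕ, ∑ _s : embeddedSpace A,
          ENNReal.ofReal (Real.exp (-beta A δ (t + 1) / 2)) := by
          refine ENNReal.tsum_le_tsum fun t => (measure_iUnion_fintype_le _ _).trans ?_
          exact Finset.sum_le_sum fun s _ =>
            h.measure_adaptive_le hσ hz t (r s) (beta_nonneg A hδ hδ1 (Nat.le_add_left 1 t))
      _ = _ := tsum_exp_neg_half_beta A hδ hδ1
  rw [ENNReal.ofReal_sub _ hδ.le, ENNReal.ofReal_one, tsub_le_iff_right]
  calc 1 = P Set.univ := measure_univ.symm
    _ ≤ P G + P (N ∪ ⋃ t, ⋃ s, E t s) := (measure_mono hcover).trans (measure_union_le _ _)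
    _ ≤ P G + ENNReal.ofReal δ := by gcongr

end Dictionary

end DictBO

/-- The constant `C` depends only on the noise level `σ` and the bound `B` on the prior variance;
the suppressed logarithmic factor is `√(1 + log T + log (d + 1) + log (1 / δ))`. -/
theorem theorem1 (σ B : ℝ) (hσ : 0 < σ) (hB : 0 < B) :
    ∃ C : ℝ, 0 < C ∧
      ∀ (m d : ℕ) (A : Fin m → Fin d → Bool)
        (kbase : (Fin m → ℝ) → (Fin m → ℝ) → ℝ)
        (_ : ∀ s ∈ DictBO.embeddedSpace A, kbase s s ≤ B)
        (δ : ℝ) (_ : 0 < δ) (_ : δ < 1)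
        (Ω : Type*) [MeasurableSpace Ω] (P : Measure Ω) [IsProbabilityMeasure P]
        -- a sample `f` of the zero-mean GP whose kernel is the dictionary kernel
        (f : (Fin d → Bool) → Ω → ℝ) (_ : ∀ z, Measurable (f z))
        (_ : IsGaussianProcess f P)
        (_ : ∀ z, ∫ ω, f z ω ∂P = 0)
        (_ : ∀ z z', cov[f z, f z'; P] = DictBO.dictKernel A kbase z z')
        -- independent Gaussian observation noise of variance `σ ^ 2`, independent of `f`
        (ε : ℕ → Ω → ℝ) (_ : ∀ t, Measurable (ε t))
        (_ : ∀ t, HasLaw (ε t) (gaussianReal 0 (Real.toNNReal (σ ^ 2))) P)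
        (_ : iIndepFun ε P)
        (_ : IndepFun (fun ω z => f z ω) (fun ω t => ε t ω) P)
        -- the points queried by GP-UCB
        (z : ℕ → Ω → Fin d → Bool)
        (_ : DictBO.IsGPUCBRun (DictBO.dictKernel A kbase) σ (DictBO.beta A δ) f ε z),
        ENNReal.ofReal (1 - δ) ≤
          P {ω | ∀ T : ℕ, 1 ≤ T →
            DictBO.cumRegret f z T ω ≤
              C * √(T * DictBO.maxInfoGain kbase σ (DictBO.embeddedSpace A) T * m) *
                √(1 + Real.log T + Real.log (d + 1) + Real.log (1 / δ))} := by
  -- `32 = 2² · 4 · 2`: twice the width of the bounds, `β_T ≤ 4 m L`, and the factor `2` between the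
  -- sum of the predictive variances and the information gain.
  refine ⟨√(32 * (σ ^ 2 + B)), by positivity, ?_⟩
  intro m d A kbase hkB δ hδ hδ1 Ω _ P _ f hfm hf hf0 hk ε hεm hε hεind hfε z hz
  have h : DictBO.NoisyGP (DictBO.dictKernel A kbase) σ f ε P :=
    DictBO.noisyGP_of_indepFun hfm hf hf0 hk hεm hε hεind hfε
  refine (DictBO.measure_confidence_ge hσ hδ hδ1 h hz).trans (measure_mono ?_)
  rintro ω ⟨hconst, hconf⟩ T hT
  rcases Nat.eq_zero_or_pos m with rfl | hm
  -- Without dictionary rows the embedding is constant, so `f` is constant and there is no regret.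
  · have hzero : DictBO.cumRegret f z T ω = 0 := by
      refine Finset.sum_eq_zero fun t _ => ?_
      have : ∀ p, f p ω = f (z t ω) ω := fun p => hconst _ _ (Subsingleton.elim _ _)
      simp [this]
    rw [hzero]
    positivity
  have hreg := DictBO.sum_regret_le (g := fun p => f p ω) (x := fun t => z t ω)
    (y := fun t => DictBO.obs f ε z t ω) (T := T) (β := DictBO.beta A δ T) hσ
    h.kernel_comm (fun _ => h.posSemidef_gram)
    (fun _ => h.postVar_nonneg hσ) (fun p => hkB _ ⟨p, rfl⟩)
    (fun t ht => DictBO.beta_mono A hδ hδ1 (Nat.le_add_left 1 t) ht)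
    (fun t _ p => hconf t p) (fun t _ p => hz.maximizes t ω p)
  refine hreg.trans ?_
  set L := 1 + Real.log T + Real.log (d + 1) + Real.log (1 / δ) with hL
  set γ := DictBO.maxInfoGain kbase σ (DictBO.embeddedSpace A) T
  calc _ ≤ 2 * √(4 * (m * L)) * √(T * (2 * (σ ^ 2 + B) * γ)) := by
        gcongr
        · exact DictBO.beta_le A hδ hδ1 hm hT
        · exact DictBO.infoGain_le_maxInfoGain A kbase σ _
    _ = √(32 * (σ ^ 2 + B)) * √(T * γ * m) * √L := by
        have hT' : (1 : ℝ) ≤ T := by exact_mod_cast hT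
        have h1 : 0 ≤ Real.log T := Real.log_nonneg hT'
        have h2 : 0 ≤ Real.log ((d : ℝ) + 1) :=
          Real.log_nonneg (by linarith [Nat.cast_nonneg (α := ℝ) d])
        have h3 : 0 ≤ Real.log (1 / δ) := Real.log_nonneg (by rw [le_div_iff₀ hδ]; linarith)
        have hL0 : 0 ≤ L := by linarith
        have h4 : (2 : ℝ) = √4 := by
          rw [show (4 : ℝ) = 2 ^ 2 by norm_num, Real.sqrt_sq two_pos.le]
        rw [← Real.sqrt_mul (by positivity), ← Real.sqrt_mul' _ hL0]
        nth_rewrite 1 [h4]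
        rw [← Real.sqrt_mul (by norm_num), ← Real.sqrt_mul (by positivity)]
        congr 1
        ring
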